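/- Notation. For functions $f,g$ from $\omega$ to the ordinals, $f<^*g$ means that $f(n)<g(n)$ for all but finitely many $n$. Let $\vec\kappa=\langle\kappa_n\mid n<\omega\rangle$ be a strictly increasing sequence of regular cardinals, and let $\kappa_\omega=\sup_n\kappa_n$. A sequence $\langle f_\alpha\mid\alpha<\lambda\rangle$ of functions from $\omega$ to the ordinals is a scale on $\prod_n b(n)$ if it is $<^*$-increasing, $f_\alpha<^*b$ for every $\alpha<\lambda$, and for every $g<^*b$ there is $\alpha<\lambda$ with $g<^*f_\alpha$. If $\vec f=\langle f_\alpha\mid\alpha<\lambda\rangle$ is a scale on $\prod_n\kappa_n$ and $\delta<\lambda$, then an exact upper bound (eub) of $\vec f\restriction\delta=\langle f_\alpha\mid\alpha<\delta\rangle$ is a function $g$ from $\omega$ to the ordinals such that $g(n)<\kappa_n$ for all but finitely many $n$ and $\vec f\restriction\delta$ is a scale on $\prod_n g(n)$; and $\delta$ is a continuity point of $\vec f$ if either $\vec f\restriction\delta$ has no eub, or $f_\delta$ is an eub of it. For a regular cardinal $\theta$, let $H_\theta$ be the set of all sets that are hereditarily of cardinality less than $\theta$. An algebra expanding $\langle H_\theta,\in,<_\theta,\vec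 f\rangle$ is a first-order structure with universe $H_\theta$ in a countable language which contains symbols for $\in$, for a well-ordering $<_\theta$ of $H_\theta$, and for the constant $\vec f\in H_\theta$. An elementary substructure $M\prec\mathfrak A$ is tight (for $\vec\kappa$) if $\vec\kappa\in M$ and for every $g\in\prod_n(M\cap\kappa_n)$ there is $f\in M\cap\prod_n\kappa_n$ with $g(n)<f(n)$ for all $n$. Put $\chi_M^{\vec\kappa}(n)=\sup(M\cap\kappa_n)$. For a sequence $\vec a=\langle a_\nu\mid\nu<\lambda\rangle$ of subsets of $\lambda$ of cardinality less than $\lambda$, let $S_{\vec a}$ be the set of all limit ordinals $\delta<\lambda$ for which there is a cofinal $D\subseteq\delta$ of order type $\mathrm{cf}(\delta)$ such that for every $\beta<\delta$ there is $\nu<\delta$ with $D\cap\beta=a_\nu$. Let $\mathrm{cof}(\mu)$ be the class of ordinals of cofinality $\mu$. Proposition. Let $\vec\kappa$ be as above, let $\lambda\ge\kappa_\omega^+$ be a successor cardinal, let $\vec f=\langle f_\alpha\mid\alpha<\lambda\rangle$ be a scale on $\prod_n\kappa_n$, let $\theta>\lambda$ be a regular cardinal, and let $\mathfrak A$ be an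 algebra expanding $\langle H_\theta,\in,<_\theta,\vec f\rangle$. Then for every uncountable regular cardinal $\mu<\kappa_\omega$ there are a sequence $\vec a=\langle a_\nu\mid\nu<\lambda\rangle$ of subsets of $\lambda$ of cardinality less than $\lambda$ and a closed unbounded set $C\subseteq\lambda$ such that $S_{\vec a}\cap\mathrm{cof}(\mu)$ is stationary in $\lambda$, and for every $\delta\in S_{\vec a}\cap C$ there is a tight $M\prec\mathfrak A$ such that 1. $\sup(M\cap\lambda)=\delta$; 2. $\chi_M^{\vec\kappa}$ is an eub of $\vec f\restriction\delta$; and 3. if $\delta$ is a continuity point of $\vec f$, then $\sup(M\cap\kappa_n)=f_\delta(n)$ for all but finitely many $n<\omega$. -/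

import Mathlib

open Cardinal Ordinal Filter
open scoped FirstOrder

universe u v w

namespace TightScale

/-- `H_θ`, the sets that are hereditarily of cardinality less than `θ`. For regular `θ` these are
exactly the sets whose transitive closure has cardinality less than `θ`. -/
def HSet (θ : Cardinal.{u}) : Set ZFSet.{u} :=
  {x | ZFSet.Hereditarily (fun y => y.card < θ) x}

/-- The function `g : ω → Ord` as a set of ordered pairs `(n, g n)`. -/
noncomputable def codeFun (g : ℕ → Ordinal.{u}) : ZFSet.{u} :=
  ZFSet.range (fun n : ℕ => ZFSet.pair ((n : Ordinal.{u}).toZFSet) (g n).toZFSet)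

/-- The sequence `⟨f_α | α < l⟩` of functions `ω → Ord` as a set of ordered pairs `(α, f_α)`. -/
noncomputable def codeSeq (l : Ordinal.{u}) (f : Ordinal.{u} → ℕ → Ordinal.{u}) : ZFSet.{u} :=
  ZFSet.range (fun α : Set.Iio l => ZFSet.pair (α : Ordinal.{u}).toZFSet (codeFun (f α)))

/-- The `L`-structure on `H_θ` is an algebra expanding `⟨H_θ, ∈, <_θ, c⟩`: it has countably many
symbols, among them one for membership, one for a well-ordering `<_θ` of `H_θ` and a constant
for `c` (in particular `c ∈ H_θ`). -/
structure IsAlgebraExpanding (L : FirstOrder.Language.{v, w}) (θ : Cardinal.{u})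
    [L.Structure (HSet θ)] (c : ZFSet.{u}) : Prop where
  countable : Countable L.Symbols
  exists_mem : ∃ R : L.Relations 2, ∀ x y : HSet θ,
    FirstOrder.Language.Structure.RelMap R ![x, y] ↔ (x : ZFSet.{u}) ∈ (y : ZFSet.{u})
  exists_wellOrder : ∃ R : L.Relations 2,
    IsWellOrder (HSet θ) (fun x y => FirstOrder.Language.Structure.RelMap R ![x, y])
  exists_const : ∃ k : L.Constants, (((k : HSet θ)) : ZFSet.{u}) = c

/-- The order `<*`: `f n < g n` for all but finitely many `n`. -/
def EvLT (f g : ℕ → Ordinal.{u}) : Prop :=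
  ∀ᶠ n in atTop, f n < g n

/-- `⟨f_α | α < l⟩` is a scale on `∏ₙ b n`. Membership in the product is read modulo finite; when
all `b n` are positive, the second clause is equivalent to the one in which `g` ranges over the
functions with `g n < b n` for every `n`. -/
structure IsScaleOn (l : Ordinal.{u}) (f : Ordinal.{u} → ℕ → Ordinal.{u})
    (b : ℕ → Ordinal.{u}) : Prop where
  increasing : ∀ α β, α < β → β < l → EvLT (f α) (f β)
  cofinal : ∀ g : ℕ → Ordinal.{u}, EvLT g b → ∃ α < l, EvLT g (f α)
  below : ∀ α < l, EvLT (f α) b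

/-- `g` is an exact upper bound of `f ↾ δ`, where `f` is a scale on `∏ₙ κ n`. -/
def IsEub (κ : ℕ → Cardinal.{u}) (f : Ordinal.{u} → ℕ → Ordinal.{u}) (δ : Ordinal.{u})
    (g : ℕ → Ordinal.{u}) : Prop :=
  EvLT g (fun n => (κ n).ord) ∧ IsScaleOn δ f g

/-- `δ` is a continuity point of the scale `f` on `∏ₙ κ n`. -/
def IsContinuityPoint (κ : ℕ → Cardinal.{u}) (f : Ordinal.{u} → ℕ → Ordinal.{u})
    (δ : Ordinal.{u}) : Prop :=
  (¬ ∃ g, IsEub κ f δ g) ∨ IsEub κ f δ (f δ)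

/-- `S_a`: the limit ordinals `δ < l` that are approachable with respect to `⟨a_ν | ν < l⟩`. -/
def approachable (l : Ordinal.{u}) (a : Ordinal.{u} → Set Ordinal.{u}) : Set Ordinal.{u} :=
  {δ | δ < l ∧ Order.IsSuccLimit δ ∧ ∃ D : Set Ordinal.{u}, D ⊆ Set.Iio δ ∧
    (∀ β < δ, ∃ d ∈ D, β ≤ d) ∧
    typeLT D = Ordinal.lift.{u + 1} δ.cof.ord ∧
    ∀ β < δ, ∃ ν < δ, D ∩ Set.Iio β = a ν}

/-- `S` is stationary in `l`: it meets every closed unbounded subset of `l`. -/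
def IsStationaryIn (l : Ordinal.{u}) (S : Set Ordinal.{u}) : Prop :=
  ∀ C : Set (Set.Iio l), IsClub C → ∃ δ ∈ C, (δ : Ordinal.{u}) ∈ S

/-- The set `M ∩ o` of ordinals, for a subset `M` of `H_θ`. -/
def ordTrace {θ : Cardinal.{u}} (M : Set (HSet θ)) (o : Ordinal.{u}) : Set Ordinal.{u} :=
  {α | α < o ∧ ∃ x ∈ M, (x : ZFSet.{u}) = α.toZFSet}

/-- The characteristic function `χ_M(n) = sup (M ∩ κ n)`. -/
noncomputable def charFun {θ : Cardinal.{u}} (κ : ℕ → Cardinal.{u}) (M : Set (HSet θ)) (n : ℕ) :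
    Ordinal.{u} :=
  sSup (ordTrace M (κ n).ord)

/-- `M` is tight for `κ`: the sequence `κ` belongs to `M`, and each function in `∏ₙ (M ∩ κ n)` is
pointwise dominated by a function in `M ∩ ∏ₙ κ n`. -/
structure IsTight {θ : Cardinal.{u}} (κ : ℕ → Cardinal.{u}) (M : Set (HSet θ)) : Prop where
  seq_mem : ∃ x ∈ M, (x : ZFSet.{u}) = codeFun (fun n => (κ n).ord)
  dominated : ∀ g : ℕ → Ordinal.{u}, (∀ n, g n ∈ ordTrace M (κ n).ord) →
    ∃ f : ℕ → Ordinal.{u}, (∀ n, f n < (κ n).ord) ∧ (∃ x ∈ M, (x : ZFSet.{u}) = codeFun f) ∧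
      ∀ n, g n < f n

end TightScale

namespace TightScale

/-! Let `K A` be an elementary hull of the set of ordinals `A`, with `κ` as an extra generator and
closed under countably many operations read off from the scale. The sets `a ν` have size less than
`μ`, so the hull `K (a ν)` has size at most `μ`, its trace on `lam` is bounded, and its
characteristic function lies below `κ n` for large `n`. Hence some `s ν < lam` lies above that
trace, with `f (s ν)` eventually above the characteristic function. The club consists of the `δ > ω`
closed under `s`.

If `D` witnesses that such a `δ` is approachable, then `K D` is the union of the hulls of the
initial segments of `D`, each of which is some `K (a ν)` with `ν < δ`. As `δ` has uncountable
cofinality, a countable subset of `K D` lies in a single `K (a ν)`, so it is controlled by `f (s ν)`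
with `s ν < δ`. This gives the cofinality half of the eub and, after a finite correction, tightness.
Closure of the hull under the values of the scale gives the other half, and eubs are unique modulo
finite (`IsScaleOn.eventually_eq`).

The sequence `a` comes from Shelah's theorem on stationary sets of approachable points
(`exists_stationary_approachable`), proved by club guessing on the second successor of `μ`
(`exists_club_guessing`). It is arranged that finite `a ν` are subsets of `ω`, which excludes
countable cofinality above `ω`. -/

/-! ### Transfinite recursion and suprema below a regular cardinal -/

theorem exists_transfinite_rec {X : Type v} [Inhabited X] (F : Ordinal.{u} → (Ordinal.{u} → X) → X)
    (hF : ∀ i s t, (∀ j < i, s j = t j) → F i s = F i t) :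
    ∃ s : Ordinal.{u} → X, ∀ i, s i = F i s := by
  classical
  let G : ∀ i : Ordinal.{u}, (∀ j, j < i → X) → X :=
    fun i g => F i (fun j => if h : j < i then g j h else default)
  refine ⟨WellFounded.fix Ordinal.lt_wf G, fun i => ?_⟩
  rw [WellFounded.fix_eq]
  exact hF _ _ _ fun j hj => by simp [hj]

theorem sSup_lt_ord {c : Cardinal.{u}} (hc : c.IsRegular) {s : Set Ordinal.{u}}
    (hs : #s < Cardinal.lift.{u + 1} c) (h : ∀ i ∈ s, i < c.ord) : sSup s < c.ord := by
  apply Ordinal.sSup_lt_of_lt_cof _ h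
  rwa [← Ordinal.lift_cof, hc.cof_ord]

theorem mk_Iio_lt {c : Cardinal.{u}} {i : Ordinal.{u}} (hi : i < c.ord) :
    #(Set.Iio i) < Cardinal.lift.{u + 1} c := by
  rw [Cardinal.mk_Iio_ordinal, Cardinal.lift_lt]
  exact Cardinal.lt_ord.1 hi

theorem bddAbove_image_Iio (g : Ordinal.{u} → Ordinal.{u}) (i : Ordinal.{u}) :
    BddAbove (g '' Set.Iio i) := Ordinal.bddAbove_of_small

theorem sSup_image_Iio_lt {c : Cardinal.{u}} (hc : c.IsRegular) {g : Ordinal.{u} → Ordinal.{u}}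
    {i : Ordinal.{u}} (hi : i < c.ord) (h : ∀ j < i, g j < c.ord) :
    sSup (g '' Set.Iio i) < c.ord :=
  sSup_lt_ord hc (Cardinal.mk_image_le.trans_lt (mk_Iio_lt hi)) (by rintro _ ⟨j, hj, rfl⟩; exact h j hj)

theorem succ_lt_ord {c : Cardinal.{u}} (hc : c.IsRegular) {i : Ordinal.{u}} (hi : i < c.ord) :
    i + 1 < c.ord :=
  (Cardinal.isSuccLimit_ord hc.aleph0_le).succ_lt hi

/-! ### Closure points of functions on ordinals -/

/-- `j` is closed under the function `h`. -/
def ClosedUnderFun (h : Ordinal.{u} → Ordinal.{u}) (j : Ordinal.{u}) : Prop :=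
  ∀ k < j, h k < j

theorem ClosedUnderFun.mono {h h' : Ordinal.{u} → Ordinal.{u}} {j : Ordinal.{u}}
    (hj : ClosedUnderFun h' j) (hh : ∀ k, h k ≤ h' k) : ClosedUnderFun h j :=
  fun k hk => (hh k).trans_lt (hj k hk)

theorem ClosedUnderFun.sSup {h : Ordinal.{u} → Ordinal.{u}} {s : Set Ordinal.{u}}
    (hs : BddAbove s) (h' : ∀ j ∈ s, ClosedUnderFun h j) : ClosedUnderFun h (sSup s) := by
  intro k hk
  rcases s.eq_empty_or_nonempty with rfl | hne
  · simp at hk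
  obtain ⟨j, hj, hkj⟩ := exists_lt_of_lt_csSup hne hk
  exact (h' j hj k hkj).trans_le (le_csSup hs hj)

theorem exists_closedUnderFun {c : Cardinal.{u}} (hc : c.IsRegular) (hc' : ℵ₀ < c)
    {h : Ordinal.{u} → Ordinal.{u}} (hh : ∀ k < c.ord, h k < c.ord) {b : Ordinal.{u}}
    (hb : b < c.ord) : ∃ j < c.ord, b < j ∧ ClosedUnderFun h j := by
  let s : Ordinal.{u} → Ordinal.{u} := fun k => max (k + 1) (sSup ((fun i => h i + 1) '' Set.Iio k))
  have hs : ∀ k < c.ord, s k < c.ord := fun k hk => max_lt (succ_lt_ord hc hk)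
    (sSup_image_Iio_lt hc hk fun i hi => succ_lt_ord hc (hh i (hi.trans hk)))
  let x : ℕ → Ordinal.{u} := fun n => s^[n] b
  have hx : ∀ n, x n < c.ord := by
    intro n
    induction n with
    | zero => exact hb
    | succ n ih => simp only [x, Function.iterate_succ_apply'] at ih ⊢; exact hs _ ih
  have hxs : ∀ n, x (n + 1) = s (x n) := fun n => Function.iterate_succ_apply' _ _ _
  have hbdd : BddAbove (Set.range x) := Ordinal.bddAbove_of_small
  refine ⟨sSup (Set.range x), sSup_lt_ord hc ?_ (by rintro _ ⟨n, rfl⟩; exact hx n), ?_, ?_⟩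
  · refine (Cardinal.mk_le_aleph0_iff.2 (Set.countable_range x).to_subtype).trans_lt ?_
    simpa using hc'
  · refine lt_of_lt_of_le ?_ (le_csSup hbdd ⟨1, rfl⟩)
    rw [hxs]
    exact lt_max_of_lt_left (Order.lt_succ b)
  · intro k hk
    obtain ⟨_, ⟨n, rfl⟩, hn⟩ := exists_lt_of_lt_csSup (Set.range_nonempty x) hk
    refine lt_of_lt_of_le ?_ (le_csSup hbdd ⟨n + 1, rfl⟩)
    rw [hxs]
    exact lt_max_of_lt_right ((Order.lt_succ _).trans_le
      (le_csSup (bddAbove_image_Iio _ _) ⟨k, hn, rfl⟩))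

/-- The largest ordinal below or equal to `i` that is closed under `h`. -/
noncomputable def closedFloor (h : Ordinal.{u} → Ordinal.{u}) (i : Ordinal.{u}) : Ordinal.{u} :=
  sSup {j | j ≤ i ∧ ClosedUnderFun h j}

theorem bddAbove_closedFloor (h : Ordinal.{u} → Ordinal.{u}) (i : Ordinal.{u}) :
    BddAbove {j | j ≤ i ∧ ClosedUnderFun h j} := ⟨i, fun _ hj => hj.1⟩

theorem closedFloor_le (h : Ordinal.{u} → Ordinal.{u}) (i : Ordinal.{u}) : closedFloor h i ≤ i :=
  csSup_le ⟨0, zero_le, fun _ hk => (not_lt_zero hk).elim⟩ fun _ hj => hj.1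

theorem closedUnderFun_closedFloor (h : Ordinal.{u} → Ordinal.{u}) (i : Ordinal.{u}) :
    ClosedUnderFun h (closedFloor h i) :=
  ClosedUnderFun.sSup (bddAbove_closedFloor h i) fun _ hj => hj.2

theorem le_closedFloor {h : Ordinal.{u} → Ordinal.{u}} {i j : Ordinal.{u}} (hji : j ≤ i)
    (hj : ClosedUnderFun h j) : j ≤ closedFloor h i :=
  le_csSup (bddAbove_closedFloor h i) ⟨hji, hj⟩

theorem closedFloor_mono (h : Ordinal.{u} → Ordinal.{u}) : Monotone (closedFloor h) :=
  fun i _ hij => le_closedFloor ((closedFloor_le h i).trans hij) (closedUnderFun_closedFloor h i)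

theorem closedFloor_anti {h h' : Ordinal.{u} → Ordinal.{u}} (hh : ∀ k, h k ≤ h' k)
    (i : Ordinal.{u}) : closedFloor h' i ≤ closedFloor h i :=
  le_closedFloor (closedFloor_le h' i) ((closedUnderFun_closedFloor h' i).mono hh)

/-! ### Thin cofinal sets -/

/-- `D` is a cofinal subset of `a` whose proper initial segments have cardinality less than `m`. -/
structure IsThinCofinal (m : Cardinal.{u}) (a : Ordinal.{u}) (D : Set Ordinal.{u}) : Prop where
  subset : D ⊆ Set.Iio a
  cofinal : ∀ b < a, ∃ d ∈ D, b ≤ d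
  card_lt : ∀ b < a, #(D ∩ Set.Iio b : Set Ordinal.{u}) < Cardinal.lift.{u + 1} m

theorem mk_inter_Iio (D : Set Ordinal.{u}) (b : D) :
    #(D ∩ Set.Iio (b : Ordinal.{u}) : Set Ordinal.{u}) = (typein (α := D) (· < ·) b).card := by
  rw [card_typein]
  refine Cardinal.mk_congr ⟨fun x => ⟨⟨x.1, x.2.1⟩, x.2.2⟩, fun x => ⟨x.1.1, x.1.2, x.2⟩, ?_, ?_⟩
  · intro x; rfl
  · intro x; rfl

theorem typeLT_le_of_card_lt {m : Cardinal.{u}} {D : Set Ordinal.{u}}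
    (h : ∀ b ∈ D, #(D ∩ Set.Iio b : Set Ordinal.{u}) < Cardinal.lift.{u + 1} m) :
    typeLT D ≤ Ordinal.lift.{u + 1} m.ord := by
  by_contra! hlt
  rw [Cardinal.lift_ord] at hlt
  obtain ⟨b, hb⟩ := typein_surj (α := D) (· < ·) hlt
  have := h b b.2
  rw [mk_inter_Iio, hb, card_ord] at this
  exact this.false

theorem lift_cof_le_mk {a : Ordinal.{u}} {D : Set Ordinal.{u}} (h : D ⊆ Set.Iio a)
    (h' : ∀ b < a, ∃ d ∈ D, b ≤ d) : Cardinal.lift.{u + 1} a.cof ≤ #D := by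
  rw [Ordinal.lift_cof, ← Ordinal.cof_Iio]
  have : IsCofinal (Subtype.val ⁻¹' D : Set (Set.Iio a)) := fun b => by
    obtain ⟨d, hd, hbd⟩ := h' b b.2
    exact ⟨⟨d, h hd⟩, hd, hbd⟩
  refine (Order.cof_le this).trans ?_
  exact Cardinal.mk_preimage_of_injective _ _ Subtype.val_injective

/-- Thinness bounds the order type from above, cofinality from below. Thinness is easier to carry
along than the order type: it survives monotone images and the addition of `ω`. -/
theorem IsThinCofinal.typeLT_eq {m : Cardinal.{u}} {a : Ordinal.{u}} {D : Set Ordinal.{u}}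
    (h : IsThinCofinal m a D) (ha : a.cof = m) : typeLT D = Ordinal.lift.{u + 1} a.cof.ord := by
  subst ha
  apply (typeLT_le_of_card_lt fun b hb => h.card_lt b (h.subset hb)).antisymm
  rw [Cardinal.lift_ord, ord_le, card_type]
  exact lift_cof_le_mk h.subset h.cofinal

theorem IsThinCofinal.mk_le {m : Cardinal.{u}} {a : Ordinal.{u}} {D : Set Ordinal.{u}}
    (h : IsThinCofinal m a D) : #D ≤ Cardinal.lift.{u + 1} m := by
  have := Ordinal.card_le_card (typeLT_le_of_card_lt fun b hb => h.card_lt b (h.subset hb))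
  rwa [card_type, Cardinal.lift_ord, card_ord] at this

theorem card_inter_Iio_lt_of_typeLT {m : Cardinal.{u}} {D : Set Ordinal.{u}}
    (h : typeLT D = Ordinal.lift.{u + 1} m.ord) {b : Ordinal.{u}} (hb : ∃ d ∈ D, b ≤ d) :
    #(D ∩ Set.Iio b : Set Ordinal.{u}) < Cardinal.lift.{u + 1} m := by
  obtain ⟨d, hd, hbd⟩ := hb
  refine (Cardinal.mk_le_mk_of_subset (Set.inter_subset_inter_right D (Set.Iio_subset_Iio hbd))).trans_lt ?_
  rw [mk_inter_Iio D ⟨d, hd⟩, ← lt_ord, ← Cardinal.lift_ord, ← h]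
  exact typein_lt_type _ _

theorem exists_isThinCofinal (a : Ordinal.{u}) : ∃ D, IsThinCofinal a.cof a D := by
  obtain ⟨s, hs, hst⟩ := Ordinal.exists_ord_cof_eq (α := Set.Iio a)
  rw [Ordinal.cof_Iio, ← Ordinal.lift_cof, ← Cardinal.lift_ord] at hst
  have hcof : ∀ b < a, ∃ d ∈ (Subtype.val '' s : Set Ordinal.{u}), b ≤ d := fun b hb => by
    obtain ⟨d, hd, hbd⟩ := hs ⟨b, hb⟩
    exact ⟨d, ⟨d, hd, rfl⟩, hbd⟩
  have htype : typeLT (Subtype.val '' s : Set Ordinal.{u}) = Ordinal.lift.{u + 1} a.cof.ord := by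
    rw [← hst]
    have e : ((· < ·) : s → s → Prop) ≃r
        ((· < ·) : (Subtype.val '' s : Set Ordinal.{u}) → (Subtype.val '' s : Set Ordinal.{u}) → Prop) :=
      ⟨Equiv.Set.image _ s Subtype.val_injective, Iff.rfl⟩
    exact (Ordinal.type_eq.2 ⟨e⟩).symm
  exact ⟨Subtype.val '' s, by rintro _ ⟨x, _, rfl⟩; exact x.2, hcof,
    fun b hb => card_inter_Iio_lt_of_typeLT htype (hcof b hb)⟩


theorem IsThinCofinal.image_closedFloor {m : Cardinal.{u}} {a : Ordinal.{u}} {D : Set Ordinal.{u}}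
    (h : IsThinCofinal m a D) {g : Ordinal.{u} → Ordinal.{u}}
    (hg : ∀ b < a, ∃ j < a, b ≤ j ∧ ClosedUnderFun g j) :
    IsThinCofinal m a (closedFloor g '' D) := by
  have hcof : ∀ b < a, ∃ d ∈ D, b ≤ closedFloor g d := fun b hb => by
    obtain ⟨j, hj, hbj, hjc⟩ := hg b hb
    obtain ⟨d, hd, hjd⟩ := h.cofinal j hj
    exact ⟨d, hd, hbj.trans (le_closedFloor hjd hjc)⟩
  refine ⟨?_, fun b hb => ?_, fun b hb => ?_⟩
  · rintro _ ⟨d, hd, rfl⟩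
    exact (closedFloor_le g d).trans_lt (h.subset hd)
  · obtain ⟨d, hd, hbd⟩ := hcof b hb
    exact ⟨_, ⟨d, hd, rfl⟩, hbd⟩
  · obtain ⟨d, hd, hbd⟩ := hcof b hb
    refine lt_of_le_of_lt ?_ (h.card_lt d (h.subset hd))
    refine (Cardinal.mk_le_mk_of_subset ?_).trans (Cardinal.mk_image_le (f := closedFloor g))
    rintro _ ⟨⟨e, he, rfl⟩, hlt⟩
    refine ⟨e, ⟨he, ?_⟩, rfl⟩
    by_contra! hde
    exact (hlt.trans_le (hbd.trans (closedFloor_mono g (not_lt.1 (by simpa using hde))))).false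

/-! ### Club guessing -/

/-- Every club of a regular cardinal `c > ℵ₀` has limit points of any given regular cofinality below `c`. -/
theorem exists_cof_eq_closedUnderFun {c m : Cardinal.{u}} (hc : c.IsRegular) (hm : m.IsRegular)
    (hmc : m < c) {h : Ordinal.{u} → Ordinal.{u}} (hh : ∀ k < c.ord, h k < c.ord) :
    ∃ a < c.ord, a.cof = m ∧ ∀ b < a, ∃ j < a, b ≤ j ∧ ClosedUnderFun h j := by
  have hex : ∀ b, ∃ j, b < c.ord → j < c.ord ∧ b < j ∧ ClosedUnderFun h j := fun b => by
    by_cases hb : b < c.ord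
    · obtain ⟨j, h1, h2, h3⟩ := exists_closedUnderFun hc (hm.aleph0_le.trans_lt hmc) hh hb
      exact ⟨j, fun _ => ⟨h1, h2, h3⟩⟩
    · exact ⟨0, fun h => (hb h).elim⟩
  choose N hN using hex
  obtain ⟨s, hs⟩ := exists_transfinite_rec (fun i (s : Ordinal.{u} → Ordinal.{u}) =>
    N (sSup (s '' Set.Iio i))) (fun i s t hst => by
      have : s '' Set.Iio i = t '' Set.Iio i := Set.image_congr fun j hj => hst j hj
      rw [this])
  have hlt : ∀ i < c.ord, s i < c.ord := by
    intro i
    induction i using WellFoundedLT.induction with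
    | ind i ih =>
      intro hi
      rw [hs]
      exact (hN _ (sSup_image_Iio_lt hc hi fun j hj => ih j hj (hj.trans hi))).1
  have hsup : ∀ i < c.ord, sSup (s '' Set.Iio i) < c.ord := fun i hi =>
    sSup_image_Iio_lt hc hi fun j hj => hlt j (hj.trans hi)
  have hmono : ∀ i j, j < i → i < c.ord → s j < s i := by
    intro i j hj hi
    rw [hs i]
    exact (le_csSup (bddAbove_image_Iio _ _) ⟨j, hj, rfl⟩).trans_lt (hN _ (hsup i hi)).2.1
  have hmo : m.ord < c.ord := ord_lt_ord.2 hmc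
  refine ⟨_, hsup m.ord hmo, ?_, fun b hb => ?_⟩
  · have hst : StrictMono fun i : Set.Iio m.ord => s i := fun j i hj =>
      hmono i j hj (lt_trans i.2 hmo)
    have := Ordinal.cof_iSup_Iio hst (Cardinal.isSuccLimit_ord hm.aleph0_le).isSuccPrelimit
    rw [hm.cof_ord] at this
    rw [sSup_image']
    exact this
  · have hne : (s '' Set.Iio m.ord).Nonempty := ⟨_, 0, hm.ord_pos, rfl⟩
    obtain ⟨_, ⟨i, hi, rfl⟩, hbi⟩ := exists_lt_of_lt_csSup hne hb
    have hi' := succ_lt_ord hm hi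
    refine ⟨s i, ?_, hbi.le, ?_⟩
    · exact (hmono _ _ (Order.lt_succ i) (hi'.trans hmo)).trans_le
        (le_csSup (bddAbove_image_Iio _ _) ⟨_, hi', rfl⟩)
    · rw [hs i]
      exact (hN _ (hsup i (lt_trans hi hmo))).2.2

/-- Club guessing. -/
theorem exists_club_guessing {m c : Cardinal.{u}} (hm : m.IsRegular) (hc : c.IsRegular)
    (hmc : Order.succ m < c) :
    ∃ C : Ordinal.{u} → Set Ordinal.{u}, ∀ h : Ordinal.{u} → Ordinal.{u},
      (∀ k < c.ord, h k < c.ord) →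
      ∃ a < c.ord, a.cof = m ∧ IsThinCofinal m a (C a) ∧ ∀ j ∈ C a, ClosedUnderFun h j := by
  by_contra! hcon
  -- `B C` is a function whose closure points are missed by the candidate `C` at every relevant `a`.
  choose B hB hB' using hcon
  choose T hT using exists_isThinCofinal.{u}
  -- The candidate attached to `h` rounds a fixed thin cofinal set down to closure points of `h`.
  let G : (Ordinal.{u} → Ordinal.{u}) → Ordinal.{u} → Set Ordinal.{u} :=
    fun h a => closedFloor h '' T a
  -- Each later `H i` dominates both `H j` and the function defeating the candidate of `H j`, so its
  -- closure points are closure points of both.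
  obtain ⟨H, hH⟩ := exists_transfinite_rec
    (fun i (s : Ordinal.{u} → Ordinal.{u} → Ordinal.{u}) k =>
      sSup ((fun j => max (s j k) (B (G (s j)) k)) '' Set.Iio i)) (fun i s t hst => by
      funext k
      congr 1
      exact Set.image_congr fun j hj => by rw [hst j hj])
  have hle : ∀ i j, j < i → ∀ k, max (H j k) (B (G (H j)) k) ≤ H i k := fun i j hj k => by
    rw [hH i]
    exact le_csSup (bddAbove_image_Iio (fun j => max (H j k) (B (G (H j)) k)) i) ⟨j, hj, rfl⟩
  have hsm : (Order.succ m).IsRegular := isRegular_succ hm.aleph0_le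
  set o := (Order.succ m).ord with ho
  have hoc : o < c.ord := ord_lt_ord.2 hmc
  have hHlt : ∀ i < c.ord, ∀ k < c.ord, H i k < c.ord := by
    intro i
    induction i using WellFoundedLT.induction with
    | ind i ih =>
      intro hi k hk
      rw [hH i]
      exact sSup_image_Iio_lt (g := fun j => max (H j k) (B (G (H j)) k)) hc hi fun j hj =>
        max_lt (ih j hj (hj.trans hi) k hk) (hB _ k hk)
  have hHle : ∀ i j, j ≤ i → ∀ k, H j k ≤ H i k := fun i j hj k => by
    rcases hj.eq_or_lt with rfl | hj
    · exact le_rfl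
    · exact (le_max_left _ _).trans (hle i j hj k)
  obtain ⟨a, hac, ham, ha⟩ := exists_cof_eq_closedUnderFun hc hm ((Order.lt_succ m).trans hmc)
    (hHlt o hoc)
  have hTa : IsThinCofinal m a (T a) := ham ▸ hT a
  -- For fixed `d` the floors decrease with `i`, so they are constant from the stage that attains
  -- the minimum.
  have hstab : ∀ d, ∃ i < o, ∀ i', i ≤ i' → i' < o →
      closedFloor (H i') d = closedFloor (H i) d := by
    intro d
    let V := (fun i => closedFloor (H i) d) '' Set.Iio o
    have hV : V.Nonempty := ⟨_, 0, hsm.ord_pos, rfl⟩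
    obtain ⟨i, hi, hid⟩ := csInf_mem hV
    refine ⟨i, hi, fun i' hii' hi' => le_antisymm (closedFloor_anti (hHle i' i hii') d) ?_⟩
    refine hid.le.trans (csInf_le' ⟨i', hi', rfl⟩)
  choose I hI hI' using hstab
  -- `T a` has at most `m` points and `o` is the successor of `m`, so one stage works for all of
  -- them. There the candidates of `H i` and `H (i + 1)` agree at `a`, contradicting the choice of
  -- `B`.
  have hio : sSup (I '' T a) < o := by
    refine sSup_lt_ord hsm (Cardinal.mk_image_le.trans_lt (hTa.mk_le.trans_lt ?_)) ?_
    · exact Cardinal.lift_lt.2 (Order.lt_succ m)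
    · rintro _ ⟨d, -, rfl⟩
      exact hI d
  set i := sSup (I '' T a)
  have hio' : i + 1 < o := succ_lt_ord hsm hio
  have hIi : ∀ d ∈ T a, I d ≤ i := fun d hd => le_csSup ⟨o, by
    rintro _ ⟨d, -, rfl⟩
    exact (hI d).le⟩ ⟨d, hd, rfl⟩
  obtain ⟨j, ⟨d, hd, rfl⟩, hj⟩ := hB' (G (H i)) a hac ham
    (hTa.image_closedFloor fun b hb => by
      obtain ⟨j, hj, hbj, hjc⟩ := ha b hb
      exact ⟨j, hj, hbj, hjc.mono (hHle o i hio.le)⟩)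
  apply hj
  have h1 : closedFloor (H i) d = closedFloor (H (i + 1)) d := by
    rw [hI' d i (hIi d hd) hio, hI' d (i + 1) ((hIi d hd).trans (Order.le_succ i)) hio']
  rw [h1]
  exact (closedUnderFun_closedFloor _ d).mono fun k =>
    (le_max_right _ _).trans (hle (i + 1) i (Order.lt_succ i) k)

/-! ### A stationary set of approachable points -/

/-- The supremum of the values of `s` below `j`. -/
noncomputable def supBelow (s : Ordinal.{u} → Ordinal.{u}) (j : Ordinal.{u}) : Ordinal.{u} :=
  sSup (s '' Set.Iio j)

theorem le_supBelow (s : Ordinal.{u} → Ordinal.{u}) {i j : Ordinal.{u}} (h : i < j) :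
    s i ≤ supBelow s j := le_csSup (bddAbove_image_Iio _ _) ⟨i, h, rfl⟩

theorem supBelow_le {s : Ordinal.{u} → Ordinal.{u}} {j b : Ordinal.{u}} (h : ∀ i < j, s i ≤ b) :
    supBelow s j ≤ b := csSup_le' (by rintro _ ⟨i, hi, rfl⟩; exact h i hi)

theorem supBelow_congr {s t : Ordinal.{u} → Ordinal.{u}} {j : Ordinal.{u}}
    (h : ∀ i < j, s i = t i) : supBelow s j = supBelow t j := by
  exact congrArg sSup (Set.image_congr fun i hi => h i hi)

theorem supBelow_mono (s : Ordinal.{u} → Ordinal.{u}) : Monotone (supBelow s) :=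
  fun _ _ hij => supBelow_le fun _ hk => le_supBelow s (hk.trans_le hij)

theorem lt_supBelow {s : Ordinal.{u} → Ordinal.{u}} {j b : Ordinal.{u}} (h : b < supBelow s j) :
    ∃ i < j, b < s i := by
  by_contra! hcon
  exact (h.trans_le (supBelow_le hcon)).false

/-- Two cofinal maps into the same ordinal have the same suprema on a club. -/
theorem exists_supBelow_eq {c : Cardinal.{u}} {s t : Ordinal.{u} → Ordinal.{u}}
    (hst : ∀ i < c.ord, ∃ k < c.ord, s i ≤ t k) (hts : ∀ i < c.ord, ∃ k < c.ord, t i ≤ s k) :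
    ∃ h : Ordinal.{u} → Ordinal.{u}, (∀ k < c.ord, h k < c.ord) ∧
      ∀ j ≤ c.ord, ClosedUnderFun h j → supBelow s j = supBelow t j := by
  choose! p hp hp' using hst
  choose! q hq hq' using hts
  -- Below a closure point the two maps interleave.
  refine ⟨fun k => max (p k) (q k), fun k hk => max_lt (hp k hk) (hq k hk), fun j hj hjc => ?_⟩
  refine le_antisymm (supBelow_le fun i hi => ?_) (supBelow_le fun i hi => ?_)
  · exact (hp' i (hi.trans_le hj)).trans
      (le_supBelow t ((le_max_left _ _).trans_lt (hjc i hi)))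
  · exact (hq' i (hi.trans_le hj)).trans
      (le_supBelow s ((le_max_right _ _).trans_lt (hjc i hi)))

theorem exists_enumeration {lam : Cardinal.{u}} (hlam : ℵ₀ ≤ lam)
    (F : Ordinal.{u} → Ordinal.{u} → Ordinal.{u} → Ordinal.{u} → Set Ordinal.{u}) :
    ∃ a : Ordinal.{u} → Set Ordinal.{u},
      (∀ ν < lam.ord, ∃ i j k l, a ν = F i j k l) ∧
      ∀ i < lam.ord, ∀ j < lam.ord, ∀ k < lam.ord, ∀ l < lam.ord, ∃ ν < lam.ord, a ν = F i j k l := by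
  let A := Set.Iio lam.ord
  have hA : ℵ₀ ≤ #A := by
    rw [Cardinal.mk_Iio_ordinal, card_ord]
    simpa using hlam
  have h : #A = #(A × A × A × A) := by
    simp only [Cardinal.mk_prod, Cardinal.lift_id, Cardinal.mul_eq_self hA]
  obtain ⟨q⟩ := Cardinal.eq.1 h
  classical
  refine ⟨fun ν => if hν : ν < lam.ord then
    F (q ⟨ν, hν⟩).1 (q ⟨ν, hν⟩).2.1 (q ⟨ν, hν⟩).2.2.1 (q ⟨ν, hν⟩).2.2.2 else ∅, ?_, ?_⟩
  · intro ν hν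
    simp only [hν, dite_true]
    exact ⟨_, _, _, _, rfl⟩
  · intro i hi j hj k hk l hl
    refine ⟨(q.symm ⟨⟨i, hi⟩, ⟨j, hj⟩, ⟨k, hk⟩, ⟨l, hl⟩⟩).1, Subtype.property _, ?_⟩
    set y := q.symm ⟨⟨i, hi⟩, ⟨j, hj⟩, ⟨k, hk⟩, ⟨l, hl⟩⟩ with hy
    have h2 : y.1 < lam.ord := y.2
    have h3 : q ⟨y.1, h2⟩ = ⟨⟨i, hi⟩, ⟨j, hj⟩, ⟨k, hk⟩, ⟨l, hl⟩⟩ := q.apply_symm_apply _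
    simp only [h2, dite_true, h3]

/-- Given a club, an increasing sequence `s` through it is built whose initial pieces should be
enumerated early. The enumeration cannot know `s`, so it lists the pieces of a fixed cofinal map `e
δ` instead; the suprema of `s` and `e δ` agree on a club of `c`, and club guessing finds a thin
cofinal set inside that club. -/
theorem exists_stationary_approachable {lam m : Cardinal.{u}} (hlam : lam.IsRegular)
    (hm : m.IsRegular) (hm' : ℵ₀ < m) (hmlam : Order.succ (Order.succ m) < lam) :
    ∃ a : Ordinal.{u} → Set Ordinal.{u},
      (∀ ν < lam.ord, a ν ⊆ Set.Iio lam.ord ∧ #(a ν) < Cardinal.lift.{u + 1} m ∧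
        ((a ν).Finite → a ν ⊆ Set.Iio ω)) ∧
      IsStationaryIn lam.ord (approachable lam.ord a ∩ {δ | δ.cof = m}) := by
  classical
  set c := Order.succ (Order.succ m) with hcdef
  have hc : c.IsRegular := isRegular_succ (hm.aleph0_le.trans (Order.le_succ m))
  have hmc : m < c := (Order.lt_succ m).trans (Order.lt_succ _)
  have hclam : c.ord < lam.ord := ord_lt_ord.2 hmlam
  obtain ⟨C, hC⟩ := exists_club_guessing hm hc (Order.lt_succ (Order.succ m))
  have hex : ∀ δ : Ordinal.{u}, ∃ e : Ordinal.{u} → Ordinal.{u},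
      (∃ e : Ordinal.{u} → Ordinal.{u}, (∀ k < c.ord, e k < δ) ∧ ∀ b < δ, ∃ k < c.ord, b ≤ e k) →
      (∀ k < c.ord, e k < δ) ∧ ∀ b < δ, ∃ k < c.ord, b ≤ e k := fun δ => by
    by_cases h : ∃ e : Ordinal.{u} → Ordinal.{u},
        (∀ k < c.ord, e k < δ) ∧ ∀ b < δ, ∃ k < c.ord, b ≤ e k
    · exact ⟨h.choose, fun _ => h.choose_spec⟩
    · exact ⟨id, fun h' => (h h').elim⟩
  choose e he using hex
  -- Including all of `ω` makes these sets infinite, so only subsets of `ω` occur as finite terms of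
  -- `a`.
  let X : (Ordinal.{u} → Ordinal.{u}) → Ordinal.{u} → Ordinal.{u} → Set Ordinal.{u} :=
    fun s α i => Set.Iio ω ∪ supBelow s '' (C α ∩ Set.Iio i)
  have hXcongr : ∀ s t α i, (∀ j < i, s j = t j) → X s α i = X t α i := fun s t α i h => by
    have : supBelow s '' (C α ∩ Set.Iio i) = supBelow t '' (C α ∩ Set.Iio i) :=
      Set.image_congr fun j hj => supBelow_congr fun k hk => h k (hk.trans hj.2)
    simp only [X, this]
  let F : Ordinal.{u} → Ordinal.{u} → Ordinal.{u} → Ordinal.{u} → Set Ordinal.{u} :=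
    fun δ α i n => if n < ω then Set.Iio n else
      if X (e δ) α i ⊆ Set.Iio lam.ord ∧ #(X (e δ) α i) < Cardinal.lift.{u + 1} m then
        X (e δ) α i else ∅
  obtain ⟨a, ha, ha'⟩ := exists_enumeration hlam.aleph0_le F
  have hωm : ω < m.ord := by rwa [← ord_aleph0, ord_lt_ord]
  have hωlam : ω < lam.ord := hωm.trans ((ord_lt_ord.2 hmc).trans hclam)
  have hωm' : #(Set.Iio (ω : Ordinal.{u})) < Cardinal.lift.{u + 1} m := mk_Iio_lt hωm
  refine ⟨a, fun ν hν => ?_, fun E hE => ?_⟩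
  · obtain ⟨δ, α, i, n, hF⟩ := ha ν hν
    rw [hF]
    simp only [F]
    split_ifs with h1 h2
    · have hsub : Set.Iio n ⊆ Set.Iio (ω : Ordinal.{u}) := Set.Iio_subset_Iio h1.le
      exact ⟨hsub.trans (Set.Iio_subset_Iio hωlam.le),
        (Cardinal.mk_le_mk_of_subset hsub).trans_lt hωm', fun _ => hsub⟩
    · refine ⟨h2.1, h2.2, fun hfin => ?_⟩
      have hinf : (Set.Iio (ω : Ordinal.{u})).Infinite := by
        rw [← Set.infinite_coe_iff, Cardinal.infinite_iff, Cardinal.mk_Iio_ordinal]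
        simp
      exact (hinf (hfin.subset Set.subset_union_left)).elim
    · exact ⟨Set.empty_subset _, by simpa using hm.pos, fun _ => Set.empty_subset _⟩
  let idx : Set Ordinal.{u} → Ordinal.{u} := fun Y => sInf {ν | ν < lam.ord ∧ a ν = Y}
  have hidx : ∀ Y, idx Y < lam.ord := fun Y => by
    by_cases h : {ν | ν < lam.ord ∧ a ν = Y}.Nonempty
    · exact (csInf_mem h).1
    · rw [Set.not_nonempty_iff_eq_empty] at h
      simp only [idx, h, Ordinal.sInf_empty]
      exact hlam.ord_pos
  have hidx' : ∀ Y, (∃ ν < lam.ord, a ν = Y) → a (idx Y) = Y := fun Y h =>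
    (csInf_mem (s := {ν | ν < lam.ord ∧ a ν = Y}) h).2
  have hN : ∀ b, ∃ d, b < lam.ord → b < d ∧ ∃ hd : d < lam.ord, (⟨d, hd⟩ : Set.Iio lam.ord) ∈ E := by
    intro b
    by_cases hb : b < lam.ord
    · obtain ⟨d, hd, hbd⟩ := hE.isCofinal ⟨b + 1, succ_lt_ord hlam hb⟩
      exact ⟨d, fun _ => ⟨(Order.lt_succ b).trans_le hbd, d.2, hd⟩⟩
    · exact ⟨0, fun h => (hb h).elim⟩
  choose N hN1 hN2 hN3 using hN
  -- The bound covers the indices for every `α < c.ord`, because the guessing point is found only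
  -- after the recursion. `X s α i` depends on `s` below `i` only.
  let B : Ordinal.{u} → (Ordinal.{u} → Ordinal.{u}) → Ordinal.{u} := fun i s =>
    max (supBelow s i) (max (supBelow (fun n => idx (Set.Iio n)) ω)
      (supBelow (fun α => idx (X s α i)) c.ord))
  obtain ⟨s, hs⟩ := exists_transfinite_rec (fun i s => N (B i s)) (fun i s t hst => by
    simp only [B, supBelow_congr hst, hXcongr s t _ i hst])
  have hBlt : ∀ i < lam.ord, (∀ j < i, s j < lam.ord) → B i s < lam.ord := fun i hi h =>
    max_lt (sSup_image_Iio_lt hlam hi h) (max_lt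
      (sSup_image_Iio_lt hlam hωlam fun _ _ => hidx _)
      (sSup_image_Iio_lt hlam hclam fun _ _ => hidx _))
  have hslt : ∀ i < lam.ord, s i < lam.ord := by
    intro i
    induction i using WellFoundedLT.induction with
    | ind i ih =>
      intro hi
      rw [hs]
      exact hN2 _ (hBlt i hi fun j hj => ih j hj (hj.trans hi))
  have hBs : ∀ i < lam.ord, B i s < s i := fun i hi => by
    rw [hs i]
    exact hN1 _ (hBlt i hi fun j hj => hslt j (hj.trans hi))
  have hsE : ∀ i (hi : i < lam.ord), (⟨s i, hslt i hi⟩ : Set.Iio lam.ord) ∈ E := fun i hi => by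
    have := hN3 _ (hBlt i hi fun j hj => hslt j (hj.trans hi))
    simpa only [hs i] using this
  have hsup : ∀ i < lam.ord, supBelow s i < s i := fun i hi =>
    (le_max_left _ _).trans_lt (hBs i hi)
  have hmono : ∀ i < lam.ord, ∀ j < i, s j < s i := fun i hi j hj =>
    (le_supBelow s hj).trans_lt (hsup i hi)
  have hδ' : supBelow s c.ord < lam.ord := (hsup _ hclam).trans (hslt _ hclam)
  obtain ⟨he1, he2⟩ := he (supBelow s c.ord) ⟨s, fun k hk =>
    (hmono _ ((succ_lt_ord hc hk).trans hclam) k (Order.lt_succ k)).trans_le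
      (le_supBelow s (succ_lt_ord hc hk)), fun b hb =>
    (lt_supBelow hb).imp fun k hk => ⟨hk.1, hk.2.le⟩⟩
  obtain ⟨h, hh, hhj⟩ := exists_supBelow_eq (s := s) (t := e (supBelow s c.ord))
    (fun i hi => he2 _ ((hmono _ ((succ_lt_ord hc hi).trans hclam) i (Order.lt_succ i)).trans_le
      (le_supBelow s (succ_lt_ord hc hi))))
    (fun i hi => (lt_supBelow (he1 i hi)).imp fun k hk => ⟨hk.1, hk.2.le⟩)
  obtain ⟨α, hαc, hαm, hCα, hcl⟩ := hC h hh
  have hαlam : α < lam.ord := hαc.trans hclam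
  have hαlim : Order.IsSuccLimit α := by
    rw [← Ordinal.one_lt_cof_iff, hαm]
    exact one_lt_aleph0.trans hm'
  set δ := supBelow s α with hδ
  have hδlam : δ < lam.ord := (hsup _ hαlam).trans (hslt _ hαlam)
  have hsδ : ∀ i < α, s i < δ := fun i hi =>
    (hmono _ ((hαlim.succ_lt hi).trans hαlam) i (Order.lt_succ i)).trans_le
      (le_supBelow s (hαlim.succ_lt hi))
  have hδm : δ.cof = m := by
    have hst : StrictMono fun i : Set.Iio α => s i := fun j i hj => hmono i (lt_trans i.2 hαlam) j hj
    have := Ordinal.cof_iSup_Iio hst hαlim.isSuccPrelimit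
    rw [hαm] at this
    rw [hδ, supBelow, sSup_image']
    exact this
  have hωδ : ω < δ := by
    by_contra! hle
    have := (Ordinal.cof_le_card δ).trans (Ordinal.card_le_card hle)
    rw [hδm, card_omega0] at this
    exact (hm'.trans_le this).false
  have hXlt : ∀ i < α, #(X s α i) < Cardinal.lift.{u + 1} m := fun i hi =>
    (Cardinal.mk_union_le _ _).trans_lt (Cardinal.add_lt_of_lt (by simpa using hm.aleph0_le) hωm'
      (Cardinal.mk_image_le.trans_lt (hCα.card_lt i hi)))
  have hXe : ∀ i ∈ C α, X s α i = X (e (supBelow s c.ord)) α i := fun i hi => by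
    have : supBelow s '' (C α ∩ Set.Iio i) = supBelow (e (supBelow s c.ord)) '' (C α ∩ Set.Iio i) :=
      Set.image_congr fun j hj => hhj j ((hCα.subset hj.1).le.trans hαc.le) (hcl j hj.1)
    simp only [X, this]
  have hsupδ : ∀ i < α, supBelow s i < δ := fun i hi => (hsup i (hi.trans hαlam)).trans (hsδ i hi)
  have hcof : ∀ b < δ, ∃ d ∈ C α, b ≤ supBelow s d := fun b hb => by
    obtain ⟨i, hi, hbi⟩ := lt_supBelow hb
    obtain ⟨d, hd, hid⟩ := hCα.cofinal (i + 1) (hαlim.succ_lt hi)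
    exact ⟨d, hd, hbi.le.trans (le_supBelow s ((Order.lt_succ i).trans_le hid))⟩
  set D : Set Ordinal.{u} := Set.Iio ω ∪ supBelow s '' C α with hD
  have hDω : ∀ b ≤ ω, D ∩ Set.Iio b = Set.Iio b := fun b hb =>
    Set.inter_eq_right.2 ((Set.Iio_subset_Iio hb).trans Set.subset_union_left)
  have hDX : ∀ b < δ, ω ≤ b → ∃ i ∈ C α, D ∩ Set.Iio b = X s α i := fun b hb hbω => by
    have hne : {i | i ∈ C α ∧ b ≤ supBelow s i}.Nonempty := hcof b hb
    -- Since `supBelow s` is monotone, the part below `b` is cut off at the least point of `C α`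
    -- whose value reaches `b`.
    refine ⟨sInf {i | i ∈ C α ∧ b ≤ supBelow s i}, (csInf_mem hne).1, ?_⟩
    have h2 := (csInf_mem hne).2
    ext x
    constructor
    · rintro ⟨hx | ⟨d, hd, rfl⟩, hxb⟩
      · exact Or.inl hx
      · refine Or.inr ⟨d, ⟨hd, ?_⟩, rfl⟩
        by_contra! hle
        have h3 := h2.trans (supBelow_mono s (not_lt.1 hle))
        exact (lt_of_lt_of_le hxb h3).false
    · rintro (hx | ⟨d, ⟨hd, hdi⟩, rfl⟩)
      · exact ⟨Or.inl hx, lt_of_lt_of_le hx hbω⟩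
      · refine ⟨Or.inr ⟨d, hd, rfl⟩, ?_⟩
        by_contra! hle
        exact notMem_of_lt_csInf' (Set.mem_Iio.1 hdi)
          (show d ∈ {i | i ∈ C α ∧ b ≤ supBelow s i} from ⟨hd, not_lt.1 hle⟩)
  have hthin : IsThinCofinal m δ D := by
    refine ⟨?_, fun b hb => ?_, fun b hb => ?_⟩
    · rintro x (hx | ⟨d, hd, rfl⟩)
      · exact lt_trans hx hωδ
      · exact hsupδ d (hCα.subset hd)
    · obtain ⟨d, hd, hbd⟩ := hcof b hb
      exact ⟨_, Or.inr ⟨d, hd, rfl⟩, hbd⟩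
    · rcases le_total b ω with hbω | hbω
      · rw [hDω b hbω]
        exact (Cardinal.mk_le_mk_of_subset (Set.Iio_subset_Iio hbω)).trans_lt hωm'
      · obtain ⟨i, hi, hDi⟩ := hDX b hb hbω
        rw [hDi]
        exact hXlt i (hCα.subset hi)
  have hδlim : Order.IsSuccLimit δ := by
    rw [← Ordinal.one_lt_cof_iff, hδm]
    exact one_lt_aleph0.trans hm'
  refine ⟨⟨δ, hδlam⟩, ?_, ⟨hδlam, hδlim, D, hthin.subset, hthin.cofinal, hthin.typeLT_eq hδm,
    fun b hb => ?_⟩, hδm⟩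
  · refine hE.isLUB_mem (t := {x | ∃ i < α, s i = x.1}) ?_ ?_ ?_
    · rintro ⟨_, hx⟩ ⟨i, hi, rfl⟩
      exact hsE i (hi.trans hαlam)
    · exact ⟨⟨s 0, hslt 0 hlam.ord_pos⟩, 0, hαlim.bot_lt, rfl⟩
    · constructor
      · rintro ⟨_, hx⟩ ⟨i, hi, rfl⟩
        exact le_supBelow s hi
      · intro y hy
        refine supBelow_le (b := y.1) fun i hi => ?_
        exact hy (a := ⟨s i, hslt i (hi.trans hαlam)⟩) ⟨i, hi, rfl⟩
  · rcases lt_or_ge b ω with hbω | hbω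
    · refine ⟨idx (Set.Iio b), ?_, ?_⟩
      · refine lt_of_le_of_lt ?_ (hsδ 0 hαlim.bot_lt)
        refine le_trans ?_ (hBs 0 hlam.ord_pos).le
        exact (le_supBelow (fun n => idx (Set.Iio n)) hbω).trans
          ((le_max_left _ _).trans (le_max_right _ _))
      · rw [hDω b hbω.le, hidx']
        obtain ⟨ν, hν, hνa⟩ := ha' 0 hlam.ord_pos 0 hlam.ord_pos 0 hlam.ord_pos b (hbω.trans hωlam)
        exact ⟨ν, hν, by rw [hνa]; simp only [F, hbω, if_true]⟩
    · obtain ⟨i, hi, hDi⟩ := hDX b hb hbω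
      have hiα : i < α := hCα.subset hi
      refine ⟨idx (X s α i), ?_, ?_⟩
      · refine lt_of_le_of_lt ?_ (hsδ i hiα)
        refine le_trans ?_ (hBs i (hiα.trans hαlam)).le
        exact (le_supBelow (fun α => idx (X s α i)) hαc).trans
          ((le_max_right _ _).trans (le_max_right _ _))
      · rw [hDi, hidx']
        obtain ⟨ν, hν, hνa⟩ := ha' _ hδ' α hαlam i (hiα.trans hαlam) ω hωlam
        refine ⟨ν, hν, ?_⟩
        rw [hνa, hXe i hi]
        simp only [F, lt_self_iff_false, if_false]
        rw [if_pos]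
        rw [← hXe i hi]
        refine ⟨?_, hXlt i hiα⟩
        rintro x (hx | ⟨d, hd, rfl⟩)
        · exact lt_trans hx hωlam
        · exact (hsupδ d (hCα.subset hd.1)).trans hδlam

/-! ### Codes of ordinals and functions in `HSet θ` -/

theorem hSet_def {θ : Cardinal.{u}} {x : ZFSet.{u}} :
    x ∈ HSet θ ↔ x.card < θ ∧ ∀ y ∈ x, y ∈ HSet θ :=
  ZFSet.hereditarily_iff

theorem toZFSet_mem_hSet {θ : Cardinal.{u}} {α : Ordinal.{u}} (h : α < θ.ord) :
    α.toZFSet ∈ HSet θ := by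
  induction α using WellFoundedLT.induction with
  | ind α ih =>
    rw [hSet_def, Ordinal.card_toZFSet]
    refine ⟨lt_ord.1 h, fun y hy => ?_⟩
    obtain ⟨β, hβ, rfl⟩ := Ordinal.mem_toZFSet_iff.1 hy
    exact ih β hβ (hβ.trans h)

theorem insert_mem_hSet {θ : Cardinal.{u}} (hθ : ℵ₀ ≤ θ) {x y : ZFSet.{u}} (hx : x ∈ HSet θ)
    (hy : y ∈ HSet θ) : insert x y ∈ HSet θ := by
  rw [hSet_def]
  refine ⟨ZFSet.card_insert_le.trans_lt (add_lt_of_lt hθ (hSet_def.1 hy).1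
    (one_lt_aleph0.trans_le hθ)), fun z hz => ?_⟩
  rcases ZFSet.mem_insert_iff.1 hz with rfl | hz
  · exact hx
  · exact (hSet_def.1 hy).2 z hz

theorem singleton_mem_hSet {θ : Cardinal.{u}} (hθ : ℵ₀ ≤ θ) {x : ZFSet.{u}} (hx : x ∈ HSet θ) :
    ({x} : ZFSet.{u}) ∈ HSet θ := by
  rw [hSet_def, ZFSet.card_singleton]
  refine ⟨one_lt_aleph0.trans_le hθ, fun z hz => ?_⟩
  rwa [ZFSet.mem_singleton.1 hz]

theorem pair_mem_hSet {θ : Cardinal.{u}} (hθ : ℵ₀ ≤ θ) {x y : ZFSet.{u}} (hx : x ∈ HSet θ)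
    (hy : y ∈ HSet θ) : ZFSet.pair x y ∈ HSet θ :=
  insert_mem_hSet hθ (singleton_mem_hSet hθ hx)
    (singleton_mem_hSet hθ (insert_mem_hSet hθ hx (singleton_mem_hSet hθ hy)))

theorem codeFun_mem_hSet {θ : Cardinal.{u}} (hθ : ℵ₀ < θ) {g : ℕ → Ordinal.{u}}
    (hg : ∀ n, g n < θ.ord) : codeFun g ∈ HSet θ := by
  rw [hSet_def]
  constructor
  · refine lt_of_le_of_lt ?_ hθ
    have := ZFSet.lift_card_range_le
      (f := fun n : ℕ => ZFSet.pair ((n : Ordinal.{u}).toZFSet) (g n).toZFSet)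
    simpa [codeFun] using this
  · intro y hy
    obtain ⟨n, rfl⟩ := ZFSet.mem_range.1 hy
    refine pair_mem_hSet hθ.le (toZFSet_mem_hSet ?_) (toZFSet_mem_hSet (hg n))
    rw [lt_ord, card_nat]
    exact natCast_lt_aleph0.trans hθ

/-! ### Elementary hulls -/

/-- A language with countably many function symbols of each arity and no relation symbols. -/
def auxLanguage : FirstOrder.Language.{0, 0} := ⟨fun _ => Option ℕ, fun _ => Empty⟩

/-- The hull operators of countably many functions, among them Skolem functions. -/
theorem exists_hull {H : Type u} [Nonempty H] (L : FirstOrder.Language.{v, w}) [L.Structure H]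
    (hL : Countable L.Symbols) (op : ∀ n, Option ℕ → (Fin n → H) → H) :
    ∃ K : Set H → Set H, Monotone K ∧ (∀ s, s ⊆ K s) ∧ (∀ s, #(K s) ≤ max ℵ₀ #s) ∧
      (∀ s, ∀ x ∈ K s, ∃ t ⊆ s, t.Finite ∧ x ∈ K t) ∧
      (∀ s, ∃ M : L.ElementarySubstructure H, (M : Set H) = K s) ∧
      ∀ s n o (x : Fin n → H), (∀ i, x i ∈ K s) → op n o x ∈ K s := by
  let _ : auxLanguage.Structure H := ⟨fun {n} o x => op n o x, fun {_} r => Empty.elim r⟩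
  -- Substructures for Skolem functions are elementary, and closure under finitary operations has
  -- finite character.
  let L' := (L.sum L.skolem₁).sum auxLanguage
  have hcount : #(Σ i, L'.Functions i) ≤ ℵ₀ := by
    have h1 : Countable (Σ n, (L.sum L.skolem₁).Functions n) := by
      rw [← mk_le_aleph0_iff]
      refine FirstOrder.Language.card_functions_sum_skolem₁_le.trans (max_le le_rfl ?_)
      exact mk_le_aleph0_iff.2 hL
    have h2 : ∀ n, Countable ((L.sum L.skolem₁).Functions n) := fun n =>
      Function.Injective.countable (sigma_mk_injective (i := n))
    have h3 : ∀ n, Countable (L'.Functions n) := fun n =>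
      show Countable ((L.sum L.skolem₁).Functions n ⊕ Option ℕ) from inferInstance
    exact mk_le_aleph0_iff.2 inferInstance
  refine ⟨fun s => FirstOrder.Language.Substructure.closure L' s,
    fun s t hst => FirstOrder.Language.Substructure.closure_mono hst,
    fun s => FirstOrder.Language.Substructure.subset_closure, fun s => ?_, fun s x hx => ?_, fun s => ?_,
    fun s n o x hx => ?_⟩
  · have h := FirstOrder.Language.Substructure.lift_card_closure_le (L := L') (s := s)
    rw [← Cardinal.lift_le]
    refine h.trans (max_le ?_ ?_)
    · simp
    · rw [Cardinal.lift_max, lift_aleph0]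
      refine (add_le_max _ _).trans (max_le (max_le (le_max_right _ _) ?_) (le_max_left _ _))
      exact (lift_le_aleph0.2 hcount).trans (le_max_left _ _)
  · refine FirstOrder.Language.Substructure.closure_induction
      (p := fun x => ∃ t ⊆ s, t.Finite ∧ x ∈ FirstOrder.Language.Substructure.closure L' t) hx
      (fun x hx => ⟨{x}, Set.singleton_subset_iff.2 hx, Set.finite_singleton x,
        FirstOrder.Language.Substructure.subset_closure rfl⟩) fun f x hx => ?_
    choose t ht htf htx using hx
    exact ⟨⋃ i, t i, Set.iUnion_subset ht, Set.finite_iUnion htf,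
      FirstOrder.Language.Substructure.fun_mem _ f x fun i =>
        FirstOrder.Language.Substructure.closure_mono (Set.subset_iUnion t i) (htx i)⟩
  · exact ⟨FirstOrder.Language.Substructure.elementarySkolem₁Reduct
      (FirstOrder.Language.LHom.sumInl.substructureReduct (FirstOrder.Language.Substructure.closure L' s)), rfl⟩
  · exact FirstOrder.Language.Substructure.fun_mem (FirstOrder.Language.Substructure.closure L' s)
      (Sum.inr o : L'.Functions n) x hx

/-! ### Scales, clubs of closure points, and hulls of sets of ordinals -/

theorem EvLT.trans {f g h : ℕ → Ordinal.{u}} (hfg : EvLT f g) (hgh : EvLT g h) : EvLT f h := by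
  filter_upwards [hfg, hgh] with n h1 h2 using h1.trans h2

/-- If `b' n < b n` infinitely often, the function equal to `b'` there and `0` elsewhere is below
`b`, hence below some `f α`, which is itself below `b'`. -/
theorem IsScaleOn.eventually_le {l : Ordinal.{u}} {f : Ordinal.{u} → ℕ → Ordinal.{u}}
    {b b' : ℕ → Ordinal.{u}} (hl : 0 < l) (hb : IsScaleOn l f b) (hb' : IsScaleOn l f b') :
    ∀ᶠ n in atTop, b n ≤ b' n := by
  by_contra hcon
  have hfr : ∃ᶠ n in atTop, b' n < b n := by
    simpa only [not_eventually, not_le] using hcon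
  obtain ⟨α, hα, hgα⟩ := hb.cofinal (fun n => if b' n < b n then b' n else 0) (by
    filter_upwards [hb.below 0 hl] with n hn
    split_ifs with h
    · exact h
    · exact bot_le.trans_lt hn)
  obtain ⟨n, hn, h1, h2⟩ := (hfr.and_eventually (hgα.and (hb'.below α hα))).exists
  simp only [hn, if_true] at h1
  exact (h1.trans h2).false

theorem IsScaleOn.eventually_eq {l : Ordinal.{u}} {f : Ordinal.{u} → ℕ → Ordinal.{u}}
    {b b' : ℕ → Ordinal.{u}} (hl : 0 < l) (hb : IsScaleOn l f b) (hb' : IsScaleOn l f b') :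
    ∀ᶠ n in atTop, b n = b' n := by
  filter_upwards [hb.eventually_le hl hb', hb'.eventually_le hl hb] with n h1 h2
  exact le_antisymm h1 h2

theorem isClub_closedUnderFun {c : Cardinal.{u}} (hc : c.IsRegular) (hc' : ℵ₀ < c)
    {h : Ordinal.{u} → Ordinal.{u}} (hh : ∀ k < c.ord, h k < c.ord) {b : Ordinal.{u}}
    (hb : b < c.ord) :
    IsClub {δ : Set.Iio c.ord | b < δ ∧ ClosedUnderFun h δ} := by
  refine ⟨fun d hd hne _ a ha => ?_, fun x => ?_⟩
  · obtain ⟨x, hx⟩ := hne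
    refine ⟨(hd hx).1.trans_le (ha.1 hx), fun k hk => ?_⟩
    obtain ⟨y, hy, hky⟩ := (lt_isLUB_iff (b := (⟨k, hk.trans a.2⟩ : Set.Iio c.ord)) ha).1 hk
    exact ((hd hy).2 k hky).trans_le (ha.1 hy)
  · obtain ⟨j, hj, hbj, hjc⟩ := exists_closedUnderFun hc hc' hh (max_lt hb x.2)
    exact ⟨⟨j, hj⟩, ⟨(le_max_left _ _).trans_lt hbj, hjc⟩, ((le_max_right _ _).trans_lt hbj).le⟩

theorem exists_lt_finite_subset {δ : Ordinal.{u}} (hδ : Order.IsSuccLimit δ) {H : Type v}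
    (S : Set Ordinal.{u} → Set H) (hS : Monotone S) {D : Set Ordinal.{u}}
    (hD : ∀ x ∈ S D, ∃ β < δ, x ∈ S (D ∩ Set.Iio β)) {t : Set H} (ht : t ⊆ S D)
    (hfin : t.Finite) : ∃ β < δ, t ⊆ S (D ∩ Set.Iio β) := by
  induction t, hfin using Set.Finite.induction_on with
  | empty => exact ⟨0, hδ.bot_lt, Set.empty_subset _⟩
  | @insert x s _ _ ih =>
    obtain ⟨hx, hs⟩ := Set.insert_subset_iff.1 ht
    obtain ⟨β, hβ, hsβ⟩ := ih hs
    obtain ⟨β', hβ', hxβ⟩ := hD x hx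
    have hmono : ∀ γ ≤ max β β', S (D ∩ Set.Iio γ) ⊆ S (D ∩ Set.Iio (max β β')) := fun γ hγ =>
      hS (Set.inter_subset_inter_right D (Set.Iio_subset_Iio hγ))
    exact ⟨max β β', max_lt hβ hβ', Set.insert_subset_iff.2
      ⟨hmono _ (le_max_right _ _) hxβ, hsβ.trans (hmono _ (le_max_left _ _))⟩⟩

theorem bddAbove_ordTrace {θ : Cardinal.{u}} (M : Set (HSet θ)) (o : Ordinal.{u}) :
    BddAbove (ordTrace M o) := ⟨o, fun _ h => h.1.le⟩

theorem mk_ordTrace_le {θ : Cardinal.{u}} (M : Set (HSet θ)) (o : Ordinal.{u}) :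
    #(ordTrace M o) ≤ #M := by
  refine (Cardinal.mk_le_mk_of_subset (t := (fun x : HSet θ => x.1.rank) '' M) ?_).trans
    Cardinal.mk_image_le
  rintro α ⟨-, x, hx, hxα⟩
  exact ⟨x, hx, by simp only [hxα, Ordinal.rank_toZFSet]⟩

theorem sSup_ordTrace_lt {θ c : Cardinal.{u}} (hc : c.IsRegular) {M : Set (HSet θ)}
    (hM : #M < Cardinal.lift.{u + 1} c) : sSup (ordTrace M c.ord) < c.ord :=
  sSup_lt_ord hc ((mk_ordTrace_le M _).trans_lt hM) fun _ h => h.1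

/-- The members of `H_θ` that code an ordinal in `A`, together with `p`. -/
def codes {θ : Cardinal.{u}} (p : HSet θ) (A : Set Ordinal.{u}) : Set (HSet θ) :=
  insert p {x | ∃ α ∈ A, (x : ZFSet.{u}) = α.toZFSet}

theorem codes_mono {θ : Cardinal.{u}} (p : HSet θ) : Monotone (codes p) :=
  fun _ _ h => Set.insert_subset_insert fun _ hx => hx.imp fun _ hα => ⟨h hα.1, hα.2⟩

theorem mk_codes_le {θ : Cardinal.{u}} (p : HSet θ) (A : Set Ordinal.{u}) :
    #(codes p A) ≤ #A + 1 := by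
  refine Cardinal.mk_insert_le.trans (add_le_add_left ?_ _)
  refine Cardinal.mk_le_of_injective
    (f := fun x : {x : HSet θ | ∃ α ∈ A, (x : ZFSet.{u}) = α.toZFSet} =>
      (⟨x.2.choose, x.2.choose_spec.1⟩ : A)) fun x y hxy => ?_
  have hxy' : x.2.choose = y.2.choose := congrArg Subtype.val hxy
  apply Subtype.ext
  apply Subtype.ext
  rw [x.2.choose_spec.2, y.2.choose_spec.2, hxy']

theorem exists_lt_mem_codes {θ : Cardinal.{u}} (p : HSet θ) {D : Set Ordinal.{u}}
    {δ : Ordinal.{u}} (hδ : Order.IsSuccLimit δ) (hD : D ⊆ Set.Iio δ) {x : HSet θ}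
    (hx : x ∈ codes p D) : ∃ β < δ, x ∈ codes p (D ∩ Set.Iio β) := by
  rcases hx with rfl | ⟨α, hα, hxα⟩
  · exact ⟨0, hδ.bot_lt, Or.inl rfl⟩
  · exact ⟨α + 1, hδ.succ_lt (hD hα), Or.inr ⟨α, ⟨hα, Order.lt_succ α⟩, hxα⟩⟩

/-- An elementary hull operator on sets of ordinals that is closed under the functions needed for
the scale `f`. -/
theorem exists_scale_hull {θ : Cardinal.{u}} (p : HSet θ)
    (L : FirstOrder.Language.{v, w}) [L.Structure (HSet θ)] (hL : Countable L.Symbols)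
    (f : Ordinal.{u} → ℕ → Ordinal.{u}) :
    ∃ K : Set Ordinal.{u} → Set (HSet θ), Monotone K ∧ (∀ A, p ∈ K A) ∧
      (∀ A, ∀ α ∈ A, ∀ x : HSet θ, (x : ZFSet.{u}) = α.toZFSet → x ∈ K A) ∧
      (∀ A, #(K A) ≤ max ℵ₀ #A) ∧
      (∀ δ, Order.IsSuccLimit δ → ∀ D ⊆ Set.Iio δ, ∀ x ∈ K D, ∃ β < δ, x ∈ K (D ∩ Set.Iio β)) ∧
      (∀ A, ∃ M : L.ElementarySubstructure (HSet θ), (M : Set (HSet θ)) = K A) ∧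
      (∀ A, ∀ x ∈ K A, ∀ y : HSet θ, ∀ m, (y : ZFSet.{u}) = (f x.1.rank m + 1).toZFSet → y ∈ K A) ∧
      (∀ A, ∀ x ∈ K A, ∀ N, ∀ z : ℕ → HSet θ, (∀ i < N, z i ∈ K A) → ∀ y : HSet θ,
        (y : ZFSet.{u}) = codeFun (fun k => if k < N then (z k).1.rank + 1 else f x.1.rank k) →
        y ∈ K A) := by
  classical
  have : Nonempty (HSet θ) := ⟨p⟩
  -- Ranks decode ordinals. Argument `0` is the index into the scale; argument `k + 1` is the
  -- replacement for coordinate `k`.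
  let R : ∀ n, (Fin n → HSet θ) → ℕ → Ordinal.{u} := fun n x i =>
    if h : i < n then (x ⟨i, h⟩).1.rank else 0
  let val : ∀ n, Option ℕ → (Fin n → HSet θ) → ZFSet.{u} := fun n o x => match o with
    | some m => (f (R n x 0) m + 1).toZFSet
    | none => codeFun fun k => if k + 1 < n then R n x (k + 1) + 1 else f (R n x 0) k
  -- Values outside `HSet θ` are replaced by `p`, which is in every hull anyway.
  let op : ∀ n, Option ℕ → (Fin n → HSet θ) → HSet θ := fun n o x =>
    if h : val n o x ∈ HSet θ then ⟨_, h⟩ else p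
  have hop : ∀ n o x (y : HSet θ), (y : ZFSet.{u}) = val n o x → op n o x = y := by
    intro n o x y hy
    have h : val n o x ∈ HSet θ := hy ▸ y.2
    simp only [op, h, dite_true]
    exact Subtype.ext hy.symm
  obtain ⟨K, hmono, hsub, hcard, hfin, helem, hcl⟩ := exists_hull L hL op
  refine ⟨fun A => K (codes p A), hmono.comp (codes_mono p), fun A => hsub _ (Or.inl rfl),
    fun A α hα x hx => hsub _ (Or.inr ⟨α, hα, hx⟩), fun A => ?_, fun δ hδ D hD x hx => ?_,
    fun A => helem _, fun A x hx y m hy => ?_, fun A x hx N z hz y hy => ?_⟩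
  · refine (hcard _).trans (max_le (le_max_left _ _) ((mk_codes_le p A).trans ?_))
    refine (add_le_max _ _).trans (max_le (max_le (le_max_right _ _) ?_) (le_max_left _ _))
    exact one_lt_aleph0.le.trans (le_max_left _ _)
  · obtain ⟨t, ht, htf, hxt⟩ := hfin _ x hx
    obtain ⟨β, hβ, htβ⟩ := exists_lt_finite_subset hδ (codes p) (codes_mono p)
      (fun x hx => exists_lt_mem_codes p hδ hD hx) ht htf
    exact ⟨β, hβ, hmono htβ hxt⟩
  · rw [← hop 1 (some m) (fun _ => x) y (by simpa [val, R] using hy)]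
    exact hcl (codes p A) 1 (some m) (fun _ => x) fun _ => hx
  · rw [← hop (N + 1) none (Fin.cons x fun i => z i) y ?_]
    · refine hcl (codes p A) (N + 1) none (Fin.cons x fun i => z i) fun i => ?_
      refine Fin.cases hx (fun i => ?_) i
      exact hz i i.2
    · rw [hy]
      simp only [val]
      congr 1
      funext k
      have h0 : R (N + 1) (Fin.cons x fun i : Fin N => z i) 0 = x.1.rank := by simp [R]
      rw [h0]
      by_cases hk : k < N
      · have hk' : k + 1 < N + 1 := by omega
        have h1 : R (N + 1) (Fin.cons x fun i : Fin N => z i) (k + 1) = (z k).1.rank := by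
          simp only [R, hk', dite_true]
          have : (⟨k + 1, hk'⟩ : Fin (N + 1)) = Fin.succ ⟨k, hk⟩ := rfl
          rw [this, Fin.cons_succ]
        simp only [hk, hk', if_true, h1]
      · have hk' : ¬ k + 1 < N + 1 := by omega
        simp only [hk, hk', if_false]

theorem IsScaleOn.exists_dominating {lam : Cardinal.{u}} (hlam : lam.IsRegular)
    {f : Ordinal.{u} → ℕ → Ordinal.{u}} {b : ℕ → Ordinal.{u}} (hf : IsScaleOn lam.ord f b)
    {g : ℕ → Ordinal.{u}} (hg : EvLT g b) {β : Ordinal.{u}} (hβ : β < lam.ord) :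
    ∃ α < lam.ord, β < α ∧ EvLT g (f α) := by
  obtain ⟨α, hα, hgα⟩ := hf.cofinal g hg
  have h := succ_lt_ord hlam (max_lt hα hβ)
  refine ⟨_, h, (le_max_right α β).trans_lt (Order.lt_succ _), hgα.trans (hf.increasing _ _ ?_ h)⟩
  exact (le_max_left α β).trans_lt (Order.lt_succ _)

/-- If `δ` has uncountable cofinality, a countable subset of the hull of `D` is contained in the hull
of a bounded part of `D`. -/
theorem exists_lt_forall_mem {H : Type v} {K : Set Ordinal.{u} → Set H} (hK : Monotone K)
    {D : Set Ordinal.{u}} {δ : Ordinal.{u}} (hδ : ℵ₀ < δ.cof)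
    (hD : ∀ x ∈ K D, ∃ β < δ, x ∈ K (D ∩ Set.Iio β)) {x : ℕ → H} (hx : ∀ n, x n ∈ K D) :
    ∃ β < δ, ∀ n, x n ∈ K (D ∩ Set.Iio β) := by
  choose b hb hxb using fun n => hD (x n) (hx n)
  refine ⟨sSup (Set.range b), Ordinal.sSup_lt_of_lt_cof ?_ (by rintro _ ⟨n, rfl⟩; exact hb n),
    fun n => ?_⟩
  · rw [← Ordinal.lift_cof]
    refine (Cardinal.mk_le_aleph0_iff.2 (Set.countable_range b).to_subtype).trans_lt ?_
    rwa [Cardinal.aleph0_lt_lift]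
  · have hle : b n ≤ sSup (Set.range b) := le_csSup Ordinal.bddAbove_of_small ⟨n, rfl⟩
    exact hK (Set.inter_subset_inter_right D (Set.Iio_subset_Iio hle)) (hxb n)

end TightScale

/-! ### The proposition -/

theorem mainTheorem3
    (κ : ℕ → Cardinal.{u}) (hκ_mono : StrictMono κ) (hκ_reg : ∀ n, (κ n).IsRegular)
    (lam : Cardinal.{u}) (hlam_succ : ∃ η : Cardinal.{u}, lam = Order.succ η)
    (hlam_ge : Order.succ (⨆ n, κ n) ≤ lam)
    (f : Ordinal.{u} → ℕ → Ordinal.{u})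
    (hf : TightScale.IsScaleOn lam.ord f (fun n => (κ n).ord))
    (θ : Cardinal.{u}) (hθ_reg : θ.IsRegular) (hθ : lam < θ)
    (L : FirstOrder.Language.{v, w}) [L.Structure (TightScale.HSet θ)]
    (hA : TightScale.IsAlgebraExpanding L θ (TightScale.codeSeq lam.ord f))
    (μ : Cardinal.{u}) (hμ_reg : μ.IsRegular) (hμ_unc : ℵ₀ < μ) (hμ : μ < ⨆ n, κ n) :
    ∃ (a : Ordinal.{u} → Set Ordinal.{u}) (C : Set (Set.Iio lam.ord)),
      (∀ ν < lam.ord, a ν ⊆ Set.Iio lam.ord ∧ #(a ν) < Cardinal.lift.{u + 1} lam) ∧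
      IsClub C ∧
      TightScale.IsStationaryIn lam.ord
        (TightScale.approachable lam.ord a ∩ {δ | δ.cof = μ}) ∧
      ∀ δ ∈ C, (δ : Ordinal.{u}) ∈ TightScale.approachable lam.ord a →
        ∃ M : L.ElementarySubstructure (TightScale.HSet θ),
          TightScale.IsTight κ (M : Set (TightScale.HSet θ)) ∧
          sSup (TightScale.ordTrace (M : Set (TightScale.HSet θ)) lam.ord) = δ ∧
          TightScale.IsEub κ f δ (TightScale.charFun κ (M : Set (TightScale.HSet θ))) ∧
          (TightScale.IsContinuityPoint κ f δ →
            ∀ᶠ n in atTop,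
              sSup (TightScale.ordTrace (M : Set (TightScale.HSet θ)) (κ n).ord) = f δ n) := by
  open TightScale in
  have hbdd : BddAbove (Set.range κ) := bddAbove_of_small
  have hκle : ∀ n, κ n ≤ ⨆ n, κ n := fun n => le_ciSup hbdd n
  have hκlam : ∀ n, κ n < lam := fun n =>
    (hκle n).trans_lt ((Order.lt_succ _).trans_le hlam_ge)
  have hμlam : μ < lam := hμ.trans ((Order.lt_succ _).trans_le hlam_ge)
  have hlam : lam.IsRegular := by
    obtain ⟨η, rfl⟩ := hlam_succ
    exact isRegular_succ (hμ_unc.le.trans (Order.lt_succ_iff.1 hμlam))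
  obtain ⟨n₀, hn₀⟩ := (lt_ciSup_iff hbdd).1 hμ
  have hμκ : ∀ n ≥ n₀, μ < κ n := fun n hn => hn₀.trans_le (hκ_mono.monotone hn)
  -- The second successor of `μ` is at most `κ (n₀ + 1)`.
  have hμ2 : Order.succ (Order.succ μ) < lam :=
    (Order.succ_le_of_lt ((Order.succ_le_of_lt hn₀).trans_lt (hκ_mono (Nat.lt_succ_self n₀)))).trans_lt
      (hκlam _)
  have hℵθ : ℵ₀ < θ := hμ_unc.trans (hμlam.trans hθ)
  have hltθ : ∀ α < lam.ord, α < θ.ord := fun α hα => hα.trans (ord_lt_ord.2 hθ)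
  have hκθ : ∀ n, (κ n).ord < lam.ord := fun n => ord_lt_ord.2 (hκlam n)
  have hcodeκ : codeFun (fun n => (κ n).ord) ∈ HSet θ :=
    codeFun_mem_hSet hℵθ fun n => hltθ _ (hκθ n)
  obtain ⟨a, ha, hstat⟩ := exists_stationary_approachable hlam hμ_reg hμ_unc hμ2
  obtain ⟨K, hKmono, hKp, hKsub, hKcard, hKfin, hKelem, hKsucc, hKcode⟩ :=
    exists_scale_hull (⟨_, hcodeκ⟩ : HSet θ) L hA.countable f
  have hKlt : ∀ A : Set Ordinal.{u}, #A ≤ Cardinal.lift.{u + 1} μ → ∀ c : Cardinal.{u}, μ < c →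
      #(K A) < Cardinal.lift.{u + 1} c := fun A hA c hc =>
    ((hKcard A).trans (max_le (by simpa using hμ_unc.le) hA)).trans_lt (Cardinal.lift_lt.2 hc)
  have hchar : ∀ A : Set Ordinal.{u}, #A ≤ Cardinal.lift.{u + 1} μ →
      EvLT (charFun κ (K A)) (fun n => (κ n).ord) := fun A hA =>
    (eventually_ge_atTop n₀).mono fun n hn => sSup_ordTrace_lt (hκ_reg n) (hKlt A hA _ (hμκ n hn))
  have hs : ∀ ν, ∃ α, ν < lam.ord → α < lam.ord ∧ sSup (ordTrace (K (a ν)) lam.ord) < α ∧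
      EvLT (charFun κ (K (a ν))) (f α) := fun ν => by
    by_cases hν : ν < lam.ord
    · have haν := (ha ν hν).2.1.le
      obtain ⟨α, h1, h2, h3⟩ := hf.exists_dominating hlam (hchar _ haν)
        (sSup_ordTrace_lt hlam (hKlt _ haν _ hμlam))
      exact ⟨α, fun _ => ⟨h1, h2, h3⟩⟩
    · exact ⟨0, fun h => (hν h).elim⟩
  choose s hs1 hs2 hs3 using hs
  have hω : ω < lam.ord := by
    rw [← ord_aleph0, ord_lt_ord]
    exact hμ_unc.trans hμlam
  refine ⟨a, _, fun ν hν => ⟨(ha ν hν).1, (ha ν hν).2.1.trans (Cardinal.lift_lt.2 hμlam)⟩,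
    isClub_closedUnderFun hlam (hμ_unc.trans hμlam) hs1 hω, hstat, ?_⟩
  rintro ⟨δ, hδlam⟩ ⟨hωδ, hδs⟩ ⟨-, hδlim, D, hDδ, hDcof, hDtype, hDa⟩
  change ω < δ at hωδ
  change δ < lam.ord at hδlam
  change ClosedUnderFun s δ at hδs
  change Order.IsSuccLimit δ at hδlim
  have hDlt : ∀ b < δ, ∃ d ∈ D, b < d := fun b hb =>
    (hDcof (b + 1) (hδlim.succ_lt hb)).imp fun d hd => ⟨hd.1, (Order.lt_succ b).trans_le hd.2⟩
  have hDcard : #D ≤ Cardinal.lift.{u + 1} μ := by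
    refine IsThinCofinal.mk_le (a := δ) ⟨hDδ, hDcof, fun b hb => ?_⟩
    obtain ⟨ν, hν, hDν⟩ := hDa b hb
    rw [hDν]
    exact (ha ν (hν.trans hδlam)).2.1
  -- For countable cofinality, an initial segment of `D` containing some `d ≥ ω` would be a finite
  -- `a ν` not included in `ω`.
  have hδcof : ℵ₀ < δ.cof := by
    refine lt_of_le_of_ne ?_ fun heq => ?_
    · rw [Ordinal.aleph0_le_cof_iff, Ordinal.one_lt_cof_iff]
      exact hδlim
    · obtain ⟨d, hd, hωd⟩ := hDcof ω hωδ
      have hd' : d + 1 < δ := hδlim.succ_lt (hDδ hd)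
      obtain ⟨ν, hν, hDν⟩ := hDa (d + 1) hd'
      have hfin := card_inter_Iio_lt_of_typeLT hDtype (hDcof _ hd')
      rw [← heq, Cardinal.lift_aleph0, Cardinal.lt_aleph0_iff_set_finite, hDν] at hfin
      have hmem : d ∈ a ν := hDν ▸ ⟨hd, Order.lt_succ d⟩
      exact (hωd.trans_lt ((ha ν (hν.trans hδlam)).2.2 hfin hmem)).false
  have hKD : ∀ x ∈ K D, ∃ β < δ, x ∈ K (D ∩ Set.Iio β) := hKfin δ hδlim D hDδ
  have hKD1 : ∀ x ∈ K D, ∃ ν < δ, x ∈ K (a ν) := fun x hx => by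
    obtain ⟨β, hβ, hxβ⟩ := hKD x hx
    obtain ⟨ν, hν, hDν⟩ := hDa β hβ
    exact ⟨ν, hν, hDν ▸ hxβ⟩
  have hKDω : ∀ x : ℕ → HSet θ, (∀ n, x n ∈ K D) → ∃ ν < δ, ∀ n, x n ∈ K (a ν) := fun x hx => by
    obtain ⟨β, hβ, hxβ⟩ := exists_lt_forall_mem hKmono hδcof hKD hx
    obtain ⟨ν, hν, hDν⟩ := hDa β hβ
    exact ⟨ν, hν, fun n => hDν ▸ hxβ n⟩
  have hDmem : ∀ d ∈ D, ∃ x ∈ K D, (x : ZFSet.{u}) = d.toZFSet := fun d hd =>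
    ⟨⟨_, toZFSet_mem_hSet (hltθ d ((hDδ hd).trans hδlam))⟩, hKsub D d hd _ rfl, rfl⟩
  obtain ⟨M, hM⟩ := hKelem D
  refine ⟨M, ?_⟩
  rw [hM]
  have heub : IsEub κ f δ (charFun κ (K D)) := by
    refine ⟨hchar D hDcard, fun α β hαβ hβ => hf.increasing α β hαβ (hβ.trans hδlam), fun g hg => ?_,
      fun α hα => ?_⟩
    -- At the finitely many `n` where `g` is not below the characteristic function, the code of `κ`
    -- serves as a dummy element.
    · have hx : ∀ n, ∃ x ∈ K D, g n < charFun κ (K D) n →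
          ∃ α < (κ n).ord, (x : ZFSet.{u}) = α.toZFSet ∧ g n < α := fun n => by
        by_cases hn : g n < charFun κ (K D) n
        · obtain ⟨α, ⟨hα, x, hx, hxα⟩, hgα⟩ := exists_lt_of_lt_csSup' hn
          exact ⟨x, hx, fun _ => ⟨α, hα, hxα, hgα⟩⟩
        · exact ⟨_, hKp D, fun h => (hn h).elim⟩
      choose x hxK hx using hx
      obtain ⟨ν, hν, hxν⟩ := hKDω x hxK
      refine ⟨s ν, hδs ν hν, ?_⟩
      filter_upwards [hg, hs3 ν (hν.trans hδlam)] with n h1 h2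
      obtain ⟨α, hα, hxα, hgα⟩ := hx n h1
      exact hgα.trans ((le_csSup (bddAbove_ordTrace _ _) ⟨hα, x n, hxν n, hxα⟩).trans_lt h2)
    · obtain ⟨d, hd, hαd⟩ := hDlt α hα
      have hdlam := (hDδ hd).trans hδlam
      obtain ⟨x, hxK, hxd⟩ := hDmem d hd
      filter_upwards [hf.increasing α d hαd hdlam, hf.below d hdlam] with n h1 h2
      -- The successor of `f d n` lies in the hull, which makes `f d n` strictly smaller than the
      -- supremum.
      have h3 : f d n + 1 < (κ n).ord := succ_lt_ord (hκ_reg n) h2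
      refine h1.trans ((Order.lt_succ (f d n)).trans_le
        (le_csSup (bddAbove_ordTrace _ _) ⟨h3, ⟨_, toZFSet_mem_hSet
          (hltθ _ (h3.trans (hκθ n)))⟩, ?_, rfl⟩))
      refine hKsucc D x hxK _ n ?_
      rw [hxd, Ordinal.rank_toZFSet]
  refine ⟨⟨⟨_, hKp D, rfl⟩, fun g hg => ?_⟩, ?_, heub, fun hcont => ?_⟩
  · choose hgκ x hxK hxg using hg
    obtain ⟨ν, hν, hxν⟩ := hKDω x hxK
    obtain ⟨d, hd, hνd⟩ := hDlt (s ν) (hδs ν hν)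
    have hdlam := (hDδ hd).trans hδlam
    obtain ⟨y, hyK, hyd⟩ := hDmem d hd
    have hev : ∀ᶠ n in atTop, g n < f d n ∧ f d n < (κ n).ord := by
      filter_upwards [hs3 ν (hν.trans hδlam), hf.increasing _ d hνd hdlam, hf.below d hdlam]
        with n h1 h2 h3
      refine ⟨((le_csSup (bddAbove_ordTrace _ _) ⟨hgκ n, x n, hxν n, hxg n⟩).trans_lt h1).trans h2, h3⟩
    obtain ⟨N, hN⟩ := eventually_atTop.1 hev
    -- `f d` dominates `g` from `N` on; the earlier values are corrected using finitely many
    -- parameters from the hull.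
    have hFκ : ∀ n, (if n < N then g n + 1 else f d n) < (κ n).ord := fun n => by
      split_ifs with hn
      · exact succ_lt_ord (hκ_reg n) (hgκ n)
      · exact (hN n (not_lt.1 hn)).2
    refine ⟨fun n => if n < N then g n + 1 else f d n, hFκ, ⟨⟨_, codeFun_mem_hSet hℵθ
      fun n => hltθ _ ((hFκ n).trans (hκθ n))⟩, ?_, rfl⟩, fun n => ?_⟩
    · refine hKcode D y hyK N x (fun i _ => hxK i) _ ?_
      simp only [hyd, hxg, Ordinal.rank_toZFSet]
    · beta_reduce
      split_ifs with hn
      · exact Order.lt_succ (g n)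
      · exact (hN n (not_lt.1 hn)).1
  · apply le_antisymm
    · refine csSup_le' ?_
      rintro α ⟨hα, x, hx, hxα⟩
      obtain ⟨ν, hν, hxν⟩ := hKD1 x hx
      exact ((le_csSup (bddAbove_ordTrace _ _) ⟨hα, x, hxν, hxα⟩).trans_lt
        (hs2 ν (hν.trans hδlam))).le.trans (hδs ν hν).le
    · refine le_of_forall_lt fun b hb => ?_
      obtain ⟨d, hd, hbd⟩ := hDlt b hb
      exact hbd.trans_le (le_csSup (bddAbove_ordTrace _ _) ⟨(hDδ hd).trans hδlam, hDmem d hd⟩)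
  · rcases hcont with hno | hfδ
    · exact (hno ⟨_, heub⟩).elim
    · exact heub.2.eventually_eq hδlim.bot_lt hfδ.2
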